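/- Let $(c_n)_{n\ge 0}$ be the sequence of rational numbers determined by $c_0=1$ and $$\sum_{k=0}^{N}\frac{c_k}{N+k+1}=0\qquad\text{for all integers } N\ge 1.$$ (These are the coefficients arising from the orthorecursive expansion of the constant function $1$ with respect to the system $\{x,x^2,x^3,\dots\}$ in $L^2([0,1])$: for every $n\ge 0$ the remainder after successive projection onto $x,x^2,\dots,x^n$ is $\sum_{k=0}^{n}c_kx^k$.) Then $$c_n=O(n^{-2})\qquad(n\to\infty).$$ -/

import Mathlib

/-- The coefficients `c_n` of the orthorecursive expansion of unity with respect to the system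
`x, x ^ 2, x ^ 3, …` in `L²([0,1])`: the rational sequence with `c_0 = 1` and
`∑_{k=0}^{N} c_k / (N + k + 1) = 0` for all `N ≥ 1`.  As the coefficient of `c_N` in the
`N`-th relation is `1 / (2 N + 1)`, that relation is solved for `c_N` (with `N = n + 1`). -/
def orthorecursiveCoeff : ℕ → ℚ
  | 0 => 1
  | n + 1 => -(2 * (n + 1) + 1) *
      ∑ k : Fin (n + 1), orthorecursiveCoeff k / ((n + 1) + (k : ℕ) + 1)

theorem orthorecursiveCoeff_zero : orthorecursiveCoeff 0 = 1 := by
  rw [orthorecursiveCoeff]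

/-- The defining recurrence. -/
theorem orthorecursiveCoeff_recurrence (N : ℕ) (hN : 1 ≤ N) :
    ∑ k ∈ Finset.range (N + 1), orthorecursiveCoeff k / ((N : ℚ) + k + 1) = 0 := by
  obtain ⟨n, rfl⟩ : ∃ n, N = n + 1 := ⟨N - 1, by omega⟩
  rw [Finset.sum_range_succ, orthorecursiveCoeff, Finset.sum_range]
  push_cast
  have h : ((n : ℚ) + 1 + (n + 1) + 1) ≠ 0 := by positivity
  field_simp
  ring

section Expansion

variable {E : Type*} [NormedAddCommGroup E] [InnerProductSpace ℝ E]

/-- The remainders of the orthorecursive expansion of `v` with respect to `e_0, e_1, …`: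
starting from `v`, project successively onto `e_0`, `e_1`, … and subtract. -/
noncomputable def orthorecursiveRemainder (v : E) (e : ℕ → E) : ℕ → E
  | 0 => v
  | n + 1 => orthorecursiveRemainder v e n -
      (inner ℝ (e n) (orthorecursiveRemainder v e n) / ‖e n‖ ^ 2) • e n

/-- The `n`-th coefficient of the orthorecursive expansion of `v` with respect to `e_0, e_1, …`. -/
noncomputable def orthorecursiveExpansionCoeff (v : E) (e : ℕ → E) (n : ℕ) : ℝ :=
  inner ℝ (e n) (orthorecursiveRemainder v e n) / ‖e n‖ ^ 2

end Expansion

/-- The function `x ↦ x ^ n` as an element of `L²([0,1])`. -/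
noncomputable def monomialL2 (n : ℕ) :
    MeasureTheory.Lp ℝ 2 (MeasureTheory.volume.restrict (Set.Icc (0 : ℝ) 1)) :=
  MeasureTheory.MemLp.toLp (fun x : ℝ => x ^ n)
    (MeasureTheory.MemLp.of_bound (by fun_prop) 1
      ((MeasureTheory.ae_restrict_iff' measurableSet_Icc).2 (Filter.Eventually.of_forall
        fun x hx => by
          rw [Real.norm_eq_abs, abs_of_nonneg (pow_nonneg hx.1 n)]
          exact pow_le_one₀ hx.1 hx.2)))

theorem inner_monomialL2 (m n : ℕ) :
    inner ℝ (monomialL2 m) (monomialL2 n) = 1 / ((m : ℝ) + n + 1) := by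
  rw [MeasureTheory.L2.inner_def]
  have h : ∀ᵐ x ∂(MeasureTheory.volume.restrict (Set.Icc (0 : ℝ) 1)),
      (inner ℝ (monomialL2 m x : ℝ) (monomialL2 n x : ℝ) : ℝ) = x ^ (m + n) := by
    unfold monomialL2
    filter_upwards [MeasureTheory.MemLp.coeFn_toLp (f := fun x : ℝ => x ^ m) _,
      MeasureTheory.MemLp.coeFn_toLp (f := fun x : ℝ => x ^ n) _]
      with x h1 h2
    rw [h1, h2, pow_add]
    simp [mul_comm]
  rw [MeasureTheory.integral_congr_ae h, MeasureTheory.integral_Icc_eq_integral_Ioc,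
    ← intervalIntegral.integral_of_le zero_le_one, integral_pow]
  simp

theorem orthorecursiveRemainder_monomialL2 (n : ℕ) :
    orthorecursiveRemainder (monomialL2 0) (fun k => monomialL2 (k + 1)) n =
        ∑ k ∈ Finset.range (n + 1), (orthorecursiveCoeff k : ℝ) • monomialL2 k ∧
      orthorecursiveExpansionCoeff (monomialL2 0) (fun k => monomialL2 (k + 1)) n =
        -(orthorecursiveCoeff (n + 1) : ℝ) := by
  have key : ∀ n : ℕ,
      inner ℝ (monomialL2 (n + 1))
          (∑ k ∈ Finset.range (n + 1), (orthorecursiveCoeff k : ℝ) • monomialL2 k) /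
        ‖monomialL2 (n + 1)‖ ^ 2 = -(orthorecursiveCoeff (n + 1) : ℝ) := by
    intro n
    have h := congrArg (fun q : ℚ => (q : ℝ))
      (orthorecursiveCoeff_recurrence (n + 1) (by omega))
    simp only [Finset.sum_range_succ _ (n + 1)] at h
    push_cast at h
    rw [← real_inner_self_eq_norm_sq, inner_monomialL2, inner_sum]
    simp only [inner_smul_right, inner_monomialL2, mul_one_div]
    push_cast
    rw [eq_neg_of_add_eq_zero_left h]
    have h0 : ((n : ℝ) + 1 + (n + 1) + 1) ≠ 0 := by positivity
    field_simp
  induction n with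
  | zero =>
    have h0 : orthorecursiveRemainder (monomialL2 0) (fun k => monomialL2 (k + 1)) 0 =
        ∑ k ∈ Finset.range (0 + 1), (orthorecursiveCoeff k : ℝ) • monomialL2 k := by
      simp [orthorecursiveRemainder, orthorecursiveCoeff_zero]
    refine ⟨h0, ?_⟩
    rw [orthorecursiveExpansionCoeff, h0]
    exact key 0
  | succ n ih =>
    have h0 : orthorecursiveRemainder (monomialL2 0) (fun k => monomialL2 (k + 1)) (n + 1) =
        ∑ k ∈ Finset.range (n + 1 + 1), (orthorecursiveCoeff k : ℝ) • monomialL2 k := by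
      have h1 := ih.2
      rw [orthorecursiveExpansionCoeff] at h1
      rw [orthorecursiveRemainder, h1, ih.1, Finset.sum_range_succ _ (n + 1), neg_smul,
        sub_neg_eq_add]
    refine ⟨h0, ?_⟩
    rw [orthorecursiveExpansionCoeff, h0]
    exact key (n + 1)

/-- The sequence defined by the recurrence does come from the orthorecursive expansion of the
constant function `1` with respect to `x, x ^ 2, …` in `L²([0,1])`: for `n ≥ 1`, the expansion
coefficient at `x ^ n` is `-c_n`, so that the remainders are `∑_{k=0}^{n} c_k x ^ k`. -/
theorem orthorecursiveExpansionCoeff_monomialL2 (n : ℕ) :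
    orthorecursiveExpansionCoeff (monomialL2 0) (fun k => monomialL2 (k + 1)) n =
      -(orthorecursiveCoeff (n + 1) : ℝ) :=
  (orthorecursiveRemainder_monomialL2 n).2

/-!
Put `a_n = (n + 1) (c_0 + ⋯ + c_n)`. It suffices to show that `a` is bounded and that its
increments are `O(1 / n)`.

Summation by parts turns the `N`-th relation into a relation between partial sums, and the
combination `(N + 1)` times the `N`-th minus `(N - 1)` times the `(N - 1)`-st has a kernel that
decays fast enough: it reads `a_{i+1} = a_i - L_i`, where `L_i` (`volterraOp`) is `a_i / (2 i)` up
to lower order plus a sum of `a_j`, `j < i`, against a kernel comparable to `4 i / (i + j) ^ 3`.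
This is a discrete form of the equation `x a'(x) = -a(x) / 2 - 4 ∫_0^1 a(x t) / (1 + t) ^ 3 dt`.

The operator `L` is accretive: `∑_{i<T} a_i L_i ≥ 0` for every real sequence
(`sum_mul_volterraOp_nonneg`). Indeed `2 (2 i + 3) = 2 (i + j + 3) + 2 (i - j)` splits its kernel
into a Hilbert-type kernel `2 / ((i + j + 1) (i + j + 2))`, which is positive definite because it
comes from `∫_0^1 x ^ (i + j) (1 - x) dx`, and a remainder whose row sums telescope
(`sum_sub_div_mul_sq_add_sq`) and are, by the arithmetic-geometric inequality, dominated by the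
diagonal part of `L`.

Squaring the recurrence and summing therefore gives `a_{n+1}² ≤ D + ∑_{i≤n} L_i²`. As
`|L_i| ≤ 6 / (i + 1) · max_{j≤i} |a_j|`, a discrete Grönwall argument with the summable weights
`36 / i²` shows that `a` is bounded (`exists_bound_of_succ_eq_sub_volterraOp`). Then `L_i = O(1 / i)`
as well, and `c_{i+1} = -(L_i + a_i / (i + 1)) / (i + 2)` is `O(i⁻²)`.
-/

open Finset

/-! ### The recurrence for the scaled partial sums -/

/-- The scaled partial sums `a_n = (n + 1) (c_0 + ⋯ + c_n)` of the coefficients. -/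
noncomputable def scaledPartialSum (n : ℕ) : ℝ :=
  (n + 1) * ∑ k ∈ range (n + 1), (orthorecursiveCoeff k : ℝ)

/-- The Volterra operator `L` for which the scaled partial sums satisfy `a_{i+1} = a_i - (L a)_i`,
`i ≥ 1`. With `N = i + 1`, its diagonal coefficient is
`(2 N² + 3 N - 1) / (2 N² (2 N - 1)) = 1 / (2 N) + O(N⁻²)`. -/
noncomputable def volterraOp (a : ℕ → ℝ) (i : ℕ) : ℝ :=
  (2 * ((i : ℝ) + 1) ^ 2 + 3 * (i + 1) - 1) / (2 * ((i : ℝ) + 1) ^ 2 * (2 * i + 1)) * a i +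
    ∑ j ∈ range i, 2 * (2 * (i : ℝ) + 3) * a j / ((i + j + 1) * (i + j + 2) * (i + j + 3))

/-- Summation by parts against `1 / (y + k)`. -/
theorem sum_range_div_add_by_parts (c : ℕ → ℝ) {y : ℝ} (hy : 0 < y) (m : ℕ) :
    ∑ k ∈ range m, c k / (y + k) = (∑ k ∈ range m, c k) / (y + m) +
      ∑ j ∈ range m, (∑ k ∈ range (j + 1), c k) / ((y + j) * (y + j + 1)) := by
  induction m with
  | zero => simp
  | succ m ih =>
    rw [sum_range_succ, ih, sum_range_succ c m, sum_range_succ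
      (fun j : ℕ => (∑ k ∈ range (j + 1), c k) / ((y + j) * (y + j + 1))), sum_range_succ c m]
    have h1 : y + m ≠ 0 := by positivity
    have h2 : y + m + 1 ≠ 0 := by positivity
    push_cast
    rw [← add_assoc y]
    field_simp
    ring

/-- The defining relation, in terms of the partial sums. -/
theorem orthorecursiveCoeff_partialSum_relation {N : ℕ} (hN : 1 ≤ N) :
    (∑ k ∈ range (N + 1), (orthorecursiveCoeff k : ℝ)) / (2 * N + 2) +
      ∑ j ∈ range (N + 1), (∑ k ∈ range (j + 1), (orthorecursiveCoeff k : ℝ)) /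
        ((N + 1 + j) * (N + 2 + j)) = 0 := by
  have h := congrArg (fun q : ℚ => (q : ℝ)) (orthorecursiveCoeff_recurrence N hN)
  have h' := sum_range_div_add_by_parts (fun k => (orthorecursiveCoeff k : ℝ))
    (y := (N : ℝ) + 1) (by positivity) (N + 1)
  push_cast at h h'
  simp only [add_right_comm (N : ℝ) _ 1] at h
  rw [h] at h'
  rw [h']
  congr 1
  · congr 1; ring
  · refine sum_congr rfl fun j _ => ?_
    congr 2; ring

/-- The recurrence `a_{i+1} = a_i - (L a)_i`. It fails at `i = 0`, where the defining relation with
`N = 0` would be needed. -/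
theorem scaledPartialSum_succ {i : ℕ} (hi : 1 ≤ i) :
    scaledPartialSum (i + 1) = scaledPartialSum i - volterraOp scaledPartialSum i := by
  have h0 := orthorecursiveCoeff_partialSum_relation hi
  have h1 := orthorecursiveCoeff_partialSum_relation (N := i + 1) (by omega)
  unfold volterraOp scaledPartialSum
  set S : ℕ → ℝ := fun j => ∑ k ∈ range (j + 1), (orthorecursiveCoeff k : ℝ) with hS
  change S i / _ + ∑ j ∈ range (i + 1), S j / _ = 0 at h0
  change S (i + 1) / _ + ∑ j ∈ range (i + 1 + 1), S j / _ = 0 at h1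
  change ((i + 1 : ℕ) + 1 : ℝ) * S (i + 1) = (i + 1) * S i - (_ * ((i + 1) * S i) +
    ∑ j ∈ range i, 2 * (2 * (i : ℝ) + 3) * ((j + 1) * S j) / _)
  -- `(i + 2) (s - 1) - i (s + 1) = 2 (j + 1)` for `s = i + j + 2`: the combination of the two
  -- relations that produces the factor `j + 1` of `a_j`.
  have key : ∑ j ∈ range i, 2 * (2 * (i : ℝ) + 3) * ((j + 1) * S j) /
        ((i + j + 1) * (i + j + 2) * (i + j + 3)) =
      (2 * i + 3) * ((i + 2) * ∑ j ∈ range i, S j / (((i + 1 : ℕ) + 1 + j) * ((i + 1 : ℕ) + 2 + j)) -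
        i * ∑ j ∈ range i, S j / (((i : ℝ) + 1 + j) * (i + 2 + j))) := by
    rw [mul_sum, mul_sum, ← sum_sub_distrib, mul_sum]
    refine sum_congr rfl fun j _ => ?_
    have e1 : (i : ℝ) + j + 1 ≠ 0 := by positivity
    have e2 : (i : ℝ) + j + 2 ≠ 0 := by positivity
    have e3 : (i : ℝ) + j + 3 ≠ 0 := by positivity
    push_cast
    rw [show (i : ℝ) + 1 + 1 + j = i + j + 2 by ring, show (i : ℝ) + 1 + 2 + j = i + j + 3 by ring,
      show (i : ℝ) + 1 + j = i + j + 1 by ring, show (i : ℝ) + 2 + j = i + j + 2 by ring]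
    field_simp
    ring
  rw [key]
  rw [sum_range_succ] at h0 h1
  rw [sum_range_succ] at h1
  generalize ∑ j ∈ range i, S j / (((i + 1 : ℕ) + 1 + j) * ((i + 1 : ℕ) + 2 + j) : ℝ) = X at *
  generalize ∑ j ∈ range i, S j / (((i : ℝ) + 1 + j) * (i + 2 + j)) = Y at *
  generalize S (i + 1) = u at *
  generalize S i = v at *
  push_cast at *
  have e1 : (i : ℝ) + 1 ≠ 0 := by positivity
  have e2 : 2 * (i : ℝ) + 1 ≠ 0 := by positivity
  have e3 : 2 * (i : ℝ) + 3 ≠ 0 := by positivity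
  have e4 : (i : ℝ) + 2 ≠ 0 := by positivity
  -- The two relations, solved for the sums over `j < i`.
  have hX : X = -(u / (2 * i + 3) + v / ((2 * i + 2) * (2 * i + 3))) := by
    rw [← sub_eq_zero, ← h1]
    rw [show 2 * ((i : ℝ) + 1) + 2 = 2 * (i + 2) by ring, show (i : ℝ) + 1 + 1 + i = 2 * (i + 1) by ring,
      show (i : ℝ) + 1 + 2 + i = 2 * i + 3 by ring,
      show (i : ℝ) + 1 + 1 + (i + 1) = 2 * i + 3 by ring,
      show (i : ℝ) + 1 + 2 + (i + 1) = 2 * (i + 2) by ring, show 2 * (i : ℝ) + 2 = 2 * (i + 1) by ring]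
    field_simp
    ring
  have hY : Y = -(v / (2 * i + 1)) := by
    rw [← sub_eq_zero, ← h0]
    rw [show (i : ℝ) + 1 + i = 2 * i + 1 by ring, show (i : ℝ) + 2 + i = 2 * (i + 1) by ring,
      show 2 * (i : ℝ) + 2 = 2 * (i + 1) by ring]
    field_simp
    ring
  rw [hX, hY, show 2 * (i : ℝ) + 2 = 2 * (i + 1) by ring]
  field_simp
  ring

/-! ### Accretivity of the Volterra operator -/

/-- The kernel `1 / ((i + j + 1) (i + j + 2)) = ∫_0^1 x ^ (i + j) (1 - x) dx` is positive
semidefinite. -/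
theorem sum_mul_mul_div_nonneg (a : ℕ → ℝ) (T : ℕ) :
    0 ≤ ∑ i ∈ range T, ∑ j ∈ range T, a i * a j / (((i : ℝ) + j + 1) * (i + j + 2)) := by
  have hmono : ∀ i j : ℕ, ∫ x in (0 : ℝ)..1, a i * a j * (x ^ (i + j) - x ^ (i + j + 1)) =
      a i * a j / (((i : ℝ) + j + 1) * (i + j + 2)) := by
    intro i j
    have e1 : (i : ℝ) + j + 1 ≠ 0 := by positivity
    have e2 : (i : ℝ) + j + 2 ≠ 0 := by positivity
    rw [intervalIntegral.integral_const_mul, intervalIntegral.integral_sub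
      (Continuous.intervalIntegrable (by fun_prop) _ _)
      (Continuous.intervalIntegrable (by fun_prop) _ _), integral_pow, integral_pow]
    push_cast
    rw [show (i : ℝ) + j + 1 + 1 = i + j + 2 by ring]
    simp only [one_pow, ne_eq, Nat.add_eq_zero_iff, one_ne_zero, and_false, not_false_eq_true,
      zero_pow, sub_zero]
    field_simp
    ring
  have hint : ∫ x in (0 : ℝ)..1, (∑ i ∈ range T, a i * x ^ i) ^ 2 * (1 - x) =
      ∑ i ∈ range T, ∑ j ∈ range T, a i * a j / (((i : ℝ) + j + 1) * (i + j + 2)) := by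
    simp_rw [← hmono]
    simp_rw [← fun i : ℕ => intervalIntegral.integral_finsetSum (μ := MeasureTheory.volume)
      (a := (0 : ℝ)) (b := 1) (s := range T)
      (f := fun (j : ℕ) (x : ℝ) => a i * a j * (x ^ (i + j) - x ^ (i + j + 1)))
      fun j _ => Continuous.intervalIntegrable (by fun_prop) _ _]
    rw [← intervalIntegral.integral_finsetSum
      fun i _ => Continuous.intervalIntegrable (by fun_prop) _ _]
    refine intervalIntegral.integral_congr fun x _ => ?_
    rw [sq, sum_mul_sum, sum_mul]
    refine sum_congr rfl fun i _ => ?_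
    rw [sum_mul]
    exact sum_congr rfl fun j _ => by ring
  rw [← hint]
  exact intervalIntegral.integral_nonneg zero_le_one fun x hx =>
    mul_nonneg (sq_nonneg _) (sub_nonneg.2 hx.2)

theorem sum_range_sum_range_of_symm (F : ℕ → ℕ → ℝ) (hF : ∀ i j, F i j = F j i) (T : ℕ) :
    ∑ i ∈ range T, ∑ j ∈ range T, F i j =
      ∑ i ∈ range T, (F i i + 2 * ∑ j ∈ range i, F i j) := by
  induction T with
  | zero => simp
  | succ T ih =>
    simp only [sum_range_succ, sum_add_distrib] at ih ⊢
    rw [ih, sum_congr rfl fun i _ => hF i T]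
    ring

/-- Row sums of the kernel `(i - j) / ((i + j + 1) (i + j + 2) (i + j + 3))`: the summand is the
difference in `j` of `(j + 1 / 2) / ((i + 1 + j) (i + 2 + j))`. -/
theorem sum_range_sub_div (i m : ℕ) :
    ∑ j ∈ range m, ((i : ℝ) - j) / ((i + j + 1) * (i + j + 2) * (i + j + 3)) =
      ((m : ℝ) + 1 / 2) / ((i + 1 + m) * (i + 2 + m)) - 1 / 2 / ((i + 1) * (i + 2)) := by
  induction m with
  | zero => simp
  | succ m ih =>
    rw [sum_range_succ, ih]
    have e1 : (i : ℝ) + m + 1 ≠ 0 := by positivity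
    have e2 : (i : ℝ) + m + 2 ≠ 0 := by positivity
    have e3 : (i : ℝ) + m + 3 ≠ 0 := by positivity
    push_cast
    rw [show (i : ℝ) + 1 + m = i + m + 1 by ring, show (i : ℝ) + 2 + m = i + m + 2 by ring,
      show (i : ℝ) + 1 + (m + 1) = i + m + 2 by ring, show (i : ℝ) + 2 + (m + 1) = i + m + 3 by ring]
    field_simp
    ring

/-- The total weight of `a_i²`, from the pairs `j < i` and the pairs `i < j < T`, is
`1 / (2 (i + 1))` minus positive terms: each half of the row contributes `1 / (4 (i + 1))`. -/
theorem sum_sub_div_mul_sq_add_sq (a : ℕ → ℝ) (T : ℕ) :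
    ∑ i ∈ range T, ∑ j ∈ range i, ((i : ℝ) - j) / ((i + j + 1) * (i + j + 2) * (i + j + 3)) *
        (a i ^ 2 + a j ^ 2) =
      ∑ i ∈ range T, a i ^ 2 * (1 / (2 * ((i : ℝ) + 1)) - 1 / (2 * (i + 1) * (i + 2)) -
        ((T : ℝ) + 1 / 2) / ((i + 1 + T) * (i + 2 + T))) := by
  induction T with
  | zero => simp
  | succ T ih =>
    rw [sum_range_succ, ih]
    have hsplit : ∑ j ∈ range T, ((T : ℝ) - j) / ((T + j + 1) * (T + j + 2) * (T + j + 3)) *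
          (a T ^ 2 + a j ^ 2) =
        (∑ j ∈ range T, ((T : ℝ) - j) / ((T + j + 1) * (T + j + 2) * (T + j + 3))) * a T ^ 2 +
        ∑ j ∈ range T, ((T : ℝ) - j) / ((T + j + 1) * (T + j + 2) * (T + j + 3)) * a j ^ 2 := by
      rw [sum_mul, ← sum_add_distrib]
      exact sum_congr rfl fun j _ => mul_add _ _ _
    rw [hsplit, sum_range_sub_div, sum_range_succ]
    -- Passing from `T` to `T + 1` adds the entry at `(T, i)` to the weight of `a_i²`.
    have hstep : ∀ i ∈ range T, a i ^ 2 * (1 / (2 * ((i : ℝ) + 1)) - 1 / (2 * (i + 1) * (i + 2)) -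
        (((T + 1 : ℕ) : ℝ) + 1 / 2) / ((i + 1 + (T + 1 : ℕ)) * (i + 2 + (T + 1 : ℕ)))) =
        a i ^ 2 * (1 / (2 * ((i : ℝ) + 1)) - 1 / (2 * (i + 1) * (i + 2)) -
        ((T : ℝ) + 1 / 2) / ((i + 1 + T) * (i + 2 + T))) +
        ((T : ℝ) - i) / ((T + i + 1) * (T + i + 2) * (T + i + 3)) * a i ^ 2 := by
      intro i _
      have e1 : (i : ℝ) + T + 1 ≠ 0 := by positivity
      have e2 : (i : ℝ) + T + 2 ≠ 0 := by positivity
      have e3 : (i : ℝ) + T + 3 ≠ 0 := by positivity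
      have e : (((T + 1 : ℕ) : ℝ) + 1 / 2) / ((i + 1 + (T + 1 : ℕ)) * (i + 2 + (T + 1 : ℕ))) =
          ((T : ℝ) + 1 / 2) / ((i + 1 + T) * (i + 2 + T)) -
          ((T : ℝ) - i) / ((T + i + 1) * (T + i + 2) * (T + i + 3)) := by
        push_cast
        rw [show (i : ℝ) + 1 + T = i + T + 1 by ring, show (i : ℝ) + 2 + T = i + T + 2 by ring,
          show (i : ℝ) + 1 + (T + 1) = i + T + 2 by ring,
          show (i : ℝ) + 2 + (T + 1) = i + T + 3 by ring, add_comm (T : ℝ) i]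
        field_simp
        ring
      rw [e]
      ring
    rw [sum_congr rfl hstep, sum_add_distrib]
    -- The weight of `a_T²` is the row sum over `j < T`.
    have hlast : (1 / (2 * ((T : ℝ) + 1)) - 1 / (2 * (T + 1) * (T + 2)) -
        (((T + 1 : ℕ) : ℝ) + 1 / 2) / ((T + 1 + (T + 1 : ℕ)) * (T + 2 + (T + 1 : ℕ)))) =
        ((T : ℝ) + 1 / 2) / ((T + 1 + T) * (T + 2 + T)) - 1 / 2 / ((T + 1) * (T + 2)) := by
      have e1 : (T : ℝ) + 1 ≠ 0 := by positivity
      have e2 : (T : ℝ) + 2 ≠ 0 := by positivity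
      have e3 : 2 * (T : ℝ) + 1 ≠ 0 := by positivity
      have e4 : 2 * (T : ℝ) + 3 ≠ 0 := by positivity
      push_cast
      rw [show (T : ℝ) + 1 + (T + 1) = 2 * (T + 1) by ring,
        show (T : ℝ) + 2 + (T + 1) = 2 * T + 3 by ring,
        show (T : ℝ) + 1 + T = 2 * T + 1 by ring, show (T : ℝ) + 2 + T = 2 * (T + 1) by ring]
      field_simp
      ring
    rw [hlast]
    ring

/-- The Volterra operator is accretive. The positive semidefinite part of the kernel is estimated
from below by `0`, and the part with the factor `i - j` by `2 a_i a_j ≥ -(a_i² + a_j²)`; the diagonal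
coefficient makes up for the latter and for the diagonal of the former. -/
theorem sum_mul_volterraOp_nonneg (a : ℕ → ℝ) (T : ℕ) :
    0 ≤ ∑ i ∈ range T, a i * volterraOp a i := by
  have hpd := sum_mul_mul_div_nonneg a T
  rw [sum_range_sum_range_of_symm _
    (fun i j => by rw [mul_comm (a i), add_comm (i : ℝ)]) T] at hpd
  have hrow := sum_sub_div_mul_sq_add_sq a T
  refine hpd.trans ?_
  suffices h : ∑ i ∈ range T, (a i * a i / (((i : ℝ) + i + 1) * (i + i + 2)) +
      2 * ∑ j ∈ range i, a i * a j / (((i : ℝ) + j + 1) * (i + j + 2))) +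
      ∑ i ∈ range T, a i ^ 2 * (1 / (2 * ((i : ℝ) + 1)) - 1 / (2 * (i + 1) * (i + 2)) -
        ((T : ℝ) + 1 / 2) / ((i + 1 + T) * (i + 2 + T))) ≤
      ∑ i ∈ range T, a i * volterraOp a i + ∑ i ∈ range T, ∑ j ∈ range i,
        ((i : ℝ) - j) / ((i + j + 1) * (i + j + 2) * (i + j + 3)) * (a i ^ 2 + a j ^ 2) by
    rw [hrow] at h
    linarith
  rw [← sum_add_distrib, ← sum_add_distrib]
  refine sum_le_sum fun i _ => ?_
  have hoff : 2 * ∑ j ∈ range i, a i * a j / (((i : ℝ) + j + 1) * (i + j + 2)) ≤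
      a i * ∑ j ∈ range i, 2 * (2 * (i : ℝ) + 3) * a j / ((i + j + 1) * (i + j + 2) * (i + j + 3)) +
      ∑ j ∈ range i,
        ((i : ℝ) - j) / ((i + j + 1) * (i + j + 2) * (i + j + 3)) * (a i ^ 2 + a j ^ 2) := by
    rw [mul_sum, mul_sum, ← sum_add_distrib]
    refine sum_le_sum fun j hj => ?_
    have hji : (j : ℝ) ≤ i := by exact_mod_cast (mem_range.1 hj).le
    have h : a i * (2 * (2 * (i : ℝ) + 3) * a j / ((i + j + 1) * (i + j + 2) * (i + j + 3))) +
        ((i : ℝ) - j) / ((i + j + 1) * (i + j + 2) * (i + j + 3)) * (a i ^ 2 + a j ^ 2) -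
        2 * (a i * a j / (((i : ℝ) + j + 1) * (i + j + 2))) =
        ((i : ℝ) - j) / ((i + j + 1) * (i + j + 2) * (i + j + 3)) * (a i + a j) ^ 2 := by
      field_simp
      ring
    rw [← sub_nonneg, h]
    have := sub_nonneg.2 hji
    positivity
  have hdiag : a i * a i / (((i : ℝ) + i + 1) * (i + i + 2)) +
      a i ^ 2 * (1 / (2 * ((i : ℝ) + 1)) - 1 / (2 * (i + 1) * (i + 2)) -
        ((T : ℝ) + 1 / 2) / ((i + 1 + T) * (i + 2 + T))) ≤
      a i * ((2 * ((i : ℝ) + 1) ^ 2 + 3 * (i + 1) - 1) /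
        (2 * ((i : ℝ) + 1) ^ 2 * (2 * i + 1)) * a i) := by
    have h : a i * ((2 * ((i : ℝ) + 1) ^ 2 + 3 * (i + 1) - 1) /
        (2 * ((i : ℝ) + 1) ^ 2 * (2 * i + 1)) * a i) -
        (a i * a i / (((i : ℝ) + i + 1) * (i + i + 2)) +
        a i ^ 2 * (1 / (2 * ((i : ℝ) + 1)) - 1 / (2 * (i + 1) * (i + 2)) -
        ((T : ℝ) + 1 / 2) / ((i + 1 + T) * (i + 2 + T)))) =
        a i ^ 2 * ((3 * i + 2) / (2 * (i + 1) ^ 2 * (2 * i + 1)) + 1 / (2 * (i + 1) * (i + 2)) +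
        ((T : ℝ) + 1 / 2) / ((i + 1 + T) * (i + 2 + T))) := by
      rw [show (i : ℝ) + i + 1 = 2 * i + 1 by ring, show (i : ℝ) + i + 2 = 2 * (i + 1) by ring]
      have e3 : 2 * (i : ℝ) + 1 ≠ 0 := by positivity
      have e1 : (i : ℝ) + 1 ≠ 0 := by positivity
      have hc : (2 * ((i : ℝ) + 1) ^ 2 + 3 * (i + 1) - 1) / (2 * ((i : ℝ) + 1) ^ 2 * (2 * i + 1)) =
          1 / ((2 * i + 1) * (2 * (i + 1))) + 1 / (2 * ((i : ℝ) + 1)) +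
          (3 * i + 2) / (2 * (i + 1) ^ 2 * (2 * i + 1)) := by
        field_simp
        ring
      rw [hc]
      ring
    rw [← sub_nonneg, h]
    positivity
  rw [volterraOp, mul_add (a i)]
  linarith

/-! ### Boundedness and the decay of the coefficients -/

theorem abs_volterraOp_le {a : ℕ → ℝ} {i : ℕ} {B : ℝ} (h : ∀ j ≤ i, |a j| ≤ B) :
    |volterraOp a i| ≤ 6 / (i + 1) * B := by
  have hB : 0 ≤ B := (abs_nonneg _).trans (h 0 (Nat.zero_le i))
  have hcoef : (2 * ((i : ℝ) + 1) ^ 2 + 3 * (i + 1) - 1) / (2 * ((i : ℝ) + 1) ^ 2 * (2 * i + 1)) ≤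
      2 / (i + 1) := by
    rw [div_le_div_iff₀ (by positivity) (by positivity)]
    have : (0 : ℝ) ≤ i := by positivity
    nlinarith [mul_nonneg this this, mul_nonneg (mul_nonneg this this) this]
  have hcoef0 : 0 ≤ (2 * ((i : ℝ) + 1) ^ 2 + 3 * (i + 1) - 1) /
      (2 * ((i : ℝ) + 1) ^ 2 * (2 * i + 1)) :=
    div_nonneg (by nlinarith [Nat.cast_nonneg (α := ℝ) i]) (by positivity)
  have hsum : |∑ j ∈ range i, 2 * (2 * (i : ℝ) + 3) * a j /
      ((i + j + 1) * (i + j + 2) * (i + j + 3))| ≤ 4 / (i + 1) * B := by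
    calc _ ≤ ∑ j ∈ range i, |2 * (2 * (i : ℝ) + 3) * a j /
          ((i + j + 1) * (i + j + 2) * (i + j + 3))| := abs_sum_le_sum_abs _ _
      _ ≤ ∑ j ∈ range i, 4 / ((i : ℝ) + 1) ^ 2 * B := by
        refine sum_le_sum fun j hj => ?_
        have hpos : 0 < ((i : ℝ) + j + 1) * (i + j + 2) * (i + j + 3) := by positivity
        rw [abs_div, abs_mul, abs_of_pos hpos, abs_of_nonneg (by positivity), mul_div_right_comm]
        refine mul_le_mul ?_ (h j (mem_range.1 hj).le) (abs_nonneg _) (by positivity)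
        rw [div_le_div_iff₀ hpos (by positivity)]
        calc 2 * (2 * (i : ℝ) + 3) * (i + 1) ^ 2 ≤ 4 * ((i + 1) * (i + 2) * (i + 3)) := by
              nlinarith [Nat.cast_nonneg (α := ℝ) i,
                mul_nonneg (Nat.cast_nonneg (α := ℝ) i) (Nat.cast_nonneg (α := ℝ) i)]
          _ ≤ _ := by gcongr <;> simp
      _ = i * (4 / ((i : ℝ) + 1) ^ 2 * B) := by simp
      _ ≤ (i + 1) * (4 / ((i : ℝ) + 1) ^ 2 * B) := by gcongr; simp
      _ = _ := by field_simp
  calc |volterraOp a i| ≤ |_| + |_| := abs_add_le _ _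
    _ ≤ 2 / (i + 1) * B + 4 / (i + 1) * B := by
      refine add_le_add ?_ hsum
      rw [abs_mul, abs_of_nonneg hcoef0]
      exact mul_le_mul hcoef (h i le_rfl) (abs_nonneg _) (by positivity)
    _ = _ := by ring

/-- Solutions of `a_{i+1} = a_i - (L a)_i`, `i ≥ 1`, are bounded: `V n = D + ∑_{1 ≤ i ≤ n} (L a)_i²`
dominates `a_j²` for `j ≤ n + 1`, and satisfies `V (n + 1) ≤ (1 + 36 / (n + 1)²) V n`. -/
theorem exists_bound_of_succ_eq_sub_volterraOp {a : ℕ → ℝ}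
    (ha : ∀ i, 1 ≤ i → a (i + 1) = a i - volterraOp a i) : ∃ B, ∀ i, |a i| ≤ B := by
  set D : ℝ := a 0 ^ 2 + a 1 ^ 2 + 2 * |a 0 * volterraOp a 0| with hD
  set V : ℕ → ℝ := fun n => D + ∑ i ∈ range n, volterraOp a (i + 1) ^ 2 with hV
  have hD0 : 0 ≤ D := by positivity
  have hV0 : ∀ n, 0 ≤ V n := fun n => add_nonneg hD0 (sum_nonneg fun i _ => sq_nonneg _)
  have hVmono : Monotone V := monotone_nat_of_le_succ fun n => by
    simp only [hV, sum_range_succ]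
    linarith [sq_nonneg (volterraOp a (n + 1))]
  -- The term `i = 0`, where the recurrence is not assumed, is added and subtracted, so that
  -- accretivity applies to the sum over all `i ≤ n`.
  have henergy : ∀ n, a (n + 1) ^ 2 = a 1 ^ 2 + 2 * (a 0 * volterraOp a 0) -
      2 * ∑ i ∈ range (n + 1), a i * volterraOp a i +
      ∑ i ∈ range n, volterraOp a (i + 1) ^ 2 := by
    intro n
    induction n with
    | zero => simp
    | succ n ih =>
      rw [ha (n + 1) (by omega), sum_range_succ (fun i => a i * volterraOp a i) (n + 1),
        sum_range_succ (fun i => volterraOp a (i + 1) ^ 2) n, sub_sq, ih]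
      ring
  have hsq_succ : ∀ n, a (n + 1) ^ 2 ≤ V n := by
    intro n
    have := sum_mul_volterraOp_nonneg a (n + 1)
    simp only [hV, hD]
    rw [henergy]
    linarith [le_abs_self (a 0 * volterraOp a 0), sq_nonneg (a 0)]
  have hsq : ∀ n j, j ≤ n + 1 → a j ^ 2 ≤ V n := by
    intro n j hj
    cases j with
    | zero =>
      refine le_trans ?_ (hVmono (Nat.zero_le n))
      simp only [hV, hD, range_zero, sum_empty, add_zero]
      nlinarith [sq_nonneg (a 1), abs_nonneg (a 0 * volterraOp a 0)]
    | succ j => exact (hsq_succ j).trans (hVmono (by omega))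
  have hVsucc : ∀ n, V (n + 1) ≤ Real.exp (36 * (1 / ((n : ℝ) + 1) ^ 2)) * V n := by
    intro n
    have h1 : |volterraOp a (n + 1)| ≤ 6 / ((n : ℝ) + 1) * √(V n) := by
      refine (abs_volterraOp_le fun j hj => Real.abs_le_sqrt (hsq n j hj)).trans ?_
      push_cast
      gcongr
      linarith
    have h2 : volterraOp a (n + 1) ^ 2 ≤ 36 * (1 / ((n : ℝ) + 1) ^ 2) * V n := by
      rw [← sq_abs]
      refine (pow_le_pow_left₀ (abs_nonneg _) h1 2).trans (le_of_eq ?_)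
      rw [mul_pow, Real.sq_sqrt (hV0 n), div_pow]
      ring
    have h3 := mul_le_mul_of_nonneg_right
      (Real.add_one_le_exp (36 * (1 / ((n : ℝ) + 1) ^ 2))) (hV0 n)
    have h4 : V (n + 1) = V n + volterraOp a (n + 1) ^ 2 := by
      simp only [hV, sum_range_succ]; ring
    linarith
  have hVexp : ∀ n, V n ≤ Real.exp (36 * ∑ i ∈ range n, 1 / ((i : ℝ) + 1) ^ 2) * D := by
    intro n
    induction n with
    | zero => simp [hV]
    | succ n ih =>
      rw [sum_range_succ, mul_add (36 : ℝ), Real.exp_add, mul_comm (Real.exp _), mul_assoc]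
      exact (hVsucc n).trans (mul_le_mul_of_nonneg_left ih (Real.exp_pos _).le)
  have hsummable : Summable fun i : ℕ => 1 / ((i : ℝ) + 1) ^ 2 := by
    have := (summable_nat_add_iff 1).2 (Real.summable_one_div_nat_pow.2 one_lt_two)
    simpa using this
  refine ⟨√(Real.exp (36 * ∑' i : ℕ, 1 / ((i : ℝ) + 1) ^ 2) * D), fun i => Real.abs_le_sqrt ?_⟩
  refine (hsq i i (by omega)).trans ((hVexp i).trans ?_)
  gcongr
  exact hsummable.sum_le_tsum _ fun i _ => by positivity

theorem theorem1p2 :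
    (fun n : ℕ => (orthorecursiveCoeff n : ℝ)) =O[Filter.atTop]
      (fun n : ℕ => (n : ℝ) ^ (-2 : ℤ)) := by
  obtain ⟨B, hB⟩ := exists_bound_of_succ_eq_sub_volterraOp fun i => scaledPartialSum_succ (i := i)
  refine Asymptotics.IsBigO.of_bound (7 * B) ?_
  filter_upwards [Filter.eventually_ge_atTop 2] with n hn
  obtain ⟨i, rfl⟩ : ∃ i, n = i + 1 := ⟨n - 1, by omega⟩
  have hB0 : 0 ≤ B := (abs_nonneg _).trans (hB 0)
  have hL := abs_volterraOp_le (a := scaledPartialSum) (i := i) fun j _ => hB j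
  have hc : (orthorecursiveCoeff (i + 1) : ℝ) =
      -(volterraOp scaledPartialSum i + scaledPartialSum i / (i + 1)) / (i + 2) := by
    have h := scaledPartialSum_succ (i := i) (by omega)
    have h' : scaledPartialSum (i + 1) = (i + 2) * (scaledPartialSum i / (i + 1) +
        (orthorecursiveCoeff (i + 1) : ℝ)) := by
      rw [scaledPartialSum, sum_range_succ, scaledPartialSum]
      push_cast
      field_simp
      ring
    rw [h'] at h
    field_simp at h ⊢
    linarith
  rw [hc, Real.norm_eq_abs, abs_div, abs_neg, abs_of_pos (by positivity : (0 : ℝ) < i + 2)]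
  have hnorm : ‖((i + 1 : ℕ) : ℝ) ^ (-2 : ℤ)‖ = 1 / ((i : ℝ) + 1) ^ 2 := by
    rw [Real.norm_eq_abs, abs_of_nonneg (by positivity), zpow_neg]
    push_cast
    rw [one_div]
    rfl
  rw [hnorm]
  have hnum : |volterraOp scaledPartialSum i + scaledPartialSum i / (i + 1)| ≤ 7 * B / (i + 1) := by
    refine (abs_add_le _ _).trans ?_
    rw [abs_div, abs_of_pos (by positivity : (0 : ℝ) < i + 1)]
    have : |scaledPartialSum i| / ((i : ℝ) + 1) ≤ B / (i + 1) := by gcongr; exact hB i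
    calc _ ≤ 6 / ((i : ℝ) + 1) * B + B / (i + 1) := add_le_add hL this
      _ = _ := by ring
  calc _ ≤ 7 * B / (i + 1) / ((i : ℝ) + 1) := by
        gcongr
        linarith
    _ = _ := by field_simp
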